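/- Call a real $2\times2$ matrix contracting if all its complex eigenvalues have modulus less than $1$, and scalar if it is a real multiple of the identity. Let $M_0,M_1$ be commuting contracting real $2\times 2$ matrices and let $u\in\mathbb R^2$ be such that the vectors $u, M_0u, M_1u$ span $\mathbb R^2$ (equivalently, $u\neq 0$ and $u$ is not a common eigenvector of $M_0$ and $M_1$). Put $M=M_0M_1=M_1M_0$ and let $\Phi=\{T_0,T_1\}$ be the iterated function system on $\mathbb R^2$ given by $T_0x=M_0x$, $T_1x=M_1x+u$. Then $\Phi$ has a unique attractor, that is, there is a unique non-empty compact set $A\subset\mathbb R^2$ with $A=T_0(A)\cup T_1(A)$. Moreover: 1. if $M$ is not scalar and $|\det M|\ge 1/\sqrt2$, then $A$ has non-empty interior; 2. if $M$ is scalar and $|\det (M_0^2M_1)|\ge 1/\sqrt2$, then $A$ has non-empty interior. -/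

import Mathlib

/-- A real `2 × 2` matrix is contracting if all its complex eigenvalues have modulus `< 1`. -/
def IsContractingMatrix (M : Matrix (Fin 2) (Fin 2) ℝ) : Prop :=
  ∀ z ∈ spectrum ℂ (M.map (algebraMap ℝ ℂ)), ‖z‖ < 1

/-- A scalar matrix: a real multiple of the identity. -/
def IsScalarMatrix (M : Matrix (Fin 2) (Fin 2) ℝ) : Prop :=
  ∃ c : ℝ, M = c • (1 : Matrix (Fin 2) (Fin 2) ℝ)

/-- The affine map `x ↦ M x + u` of the plane. -/
def affineMapOf (M : Matrix (Fin 2) (Fin 2) ℝ) (u : Fin 2 → ℝ) (x : Fin 2 → ℝ) : Fin 2 → ℝ :=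
  M.mulVec x + u

/-- `A` is an attractor of the iterated function system `{T₀, T₁}`: a non-empty compact set
with `A = T₀(A) ∪ T₁(A)`. -/
structure IsAttractor {X : Type*} [TopologicalSpace X] (T₀ T₁ : X → X) (A : Set X) : Prop where
  nonempty : A.Nonempty
  isCompact : IsCompact A
  eq_union : A = T₀ '' A ∪ T₁ '' A

/-!
The words `T₀T₁` and `T₁T₀` have the same linear part `N = M₀ M₁` and the translation parts `M₀ u`
and `u`; when `M₀ M₁` is scalar, the words `T₀T₁T₀` and `T₁T₀T₀` with `N = M₀² M₁` play this role.
So `A` contains, up to translation, the set of all sums `∑ aₙ Nⁿ w` with `aₙ ∈ {0, 1}` and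
`w = u - M₀ u`. Separating even and odd `n`, this set is `K + N K`, where `K` is the attractor
of `x ↦ N² x` and `x ↦ N² x + w`.

The hypothesis says that `|det N²| ≥ 1 / 2`. Then the two pieces of `K` meet, since otherwise
shrinking neighbourhoods of `K` would not lose volume (`PowerContracting.inter_nonempty`); hence `K`
is connected (`PowerContracting.isConnected`). The continua `K` and `N K` both contain `0`, and they
contain `w` and `N w` respectively. These vectors are linearly independent because `N` is not
scalar and `u` is not a common eigenvector (`PowerContracting.linearIndependent_sub`).

It remains to see that `K + L` has interior whenever `K`, `L` are planar continua containing `0` and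
two independent vectors `a ∈ K`, `b ∈ L` (`interior_add_nonempty`). By Baire's theorem it suffices
that the translates of `K + L` by the lattice spanned by `a` and `b` cover the plane. After a change
of coordinates the lattice is `ℤ²`, and after approximation of `K` and `L` one deals with smooth
curves `f` and `g` in the torus `ℝ² / ℤ²`. The map `(s, t) ↦ f s + g t` has degree `1`, that is,
`∫∫ φ (f s + g t) det (f' s, g' t) ds dt = ∫ φ` for every continuous `φ` on the torus. This
needs to be checked on characters only, where the left side factors into integrals along the
two curves (`integral_mFourier_mul_jacobian`). So no open set is missed
(`exists_toTorus_add_eq`).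

Existence and uniqueness of the attractor, as well as the inclusion of a translate of `K + N K`
in `A`, rest on the geometric decay of `‖M₀ ^ i * M₁ ^ j‖` in `i + j`, which Gelfand's formula
provides.
-/

/-! ### Two transversal curves in the torus -/

/-- The projection of the plane onto the torus `ℝ² / ℤ²`. -/
def toTorus (x : Fin 2 → ℝ) : UnitAddTorus (Fin 2) := fun i => (x i : UnitAddCircle)

theorem continuous_toTorus : Continuous toTorus :=
  continuous_pi fun i => (AddCircle.continuous_mk' (1 : ℝ)).comp (continuous_apply i)

/-- The normalised Haar measure of the torus `ℝ² / ℤ²`. -/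
noncomputable def torusHaar : MeasureTheory.Measure (UnitAddTorus (Fin 2)) :=
  MeasureTheory.Measure.pi fun _ => AddCircle.haarAddCircle

instance : MeasureTheory.IsProbabilityMeasure torusHaar := by
  unfold torusHaar; infer_instance

instance : MeasureTheory.Measure.IsOpenPosMeasure torusHaar := by
  unfold torusHaar; infer_instance

theorem mFourier_toTorus (n : Fin 2 → ℤ) (x : Fin 2 → ℝ) :
    UnitAddTorus.mFourier n (toTorus x) =
      Complex.exp (2 * Real.pi * Complex.I * ((n 0 * x 0 + n 1 * x 1 : ℝ) : ℂ)) := by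
  simp only [UnitAddTorus.mFourier, toTorus, ContinuousMap.coe_mk, Fin.prod_univ_two,
    fourier_coe_apply, ← Complex.exp_add]
  congr 1
  push_cast
  ring

theorem integral_fourier_eq_zero {n : ℤ} (hn : n ≠ 0) :
    ∫ x : UnitAddCircle, fourier n x ∂AddCircle.haarAddCircle = 0 := by
  exact MeasureTheory.integral_eq_zero_of_add_right_eq_neg
    (fourier_add_half_inv_index hn one_pos)

theorem integral_mFourier (n : Fin 2 → ℤ) :
    ∫ x, UnitAddTorus.mFourier n x ∂torusHaar = if n = 0 then 1 else 0 := by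
  have h : ∫ x, UnitAddTorus.mFourier n x ∂torusHaar =
      ∏ i, ∫ x : UnitAddCircle, fourier (n i) x ∂AddCircle.haarAddCircle :=
    MeasureTheory.integral_fintype_prod_eq_prod
      (fun i (x : UnitAddCircle) => (fourier (n i) x : ℂ))
  rw [h]
  split_ifs with h0
  · subst h0
    simp
  · obtain ⟨i, hi⟩ := Function.ne_iff.mp h0
    exact Finset.prod_eq_zero (Finset.mem_univ i) (integral_fourier_eq_zero hi)

/-- For a closed curve in the torus, integrating the derivative of a character along the curve
gives `0`. -/
theorem integral_character_deriv_eq_zero {f f' : ℝ → Fin 2 → ℝ}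
    (hf : ∀ i s, HasDerivAt (fun s => f s i) (f' s i) s) (hf' : ∀ i, Continuous fun s => f' s i)
    (hint : ∀ i, ∃ k : ℤ, f 1 i = f 0 i + k) (n : Fin 2 → ℤ) :
    (n 0 : ℂ) * (∫ s in (0 : ℝ)..1, UnitAddTorus.mFourier n (toTorus (f s)) * (f' s 0 : ℂ)) +
      n 1 * (∫ s in (0 : ℝ)..1, UnitAddTorus.mFourier n (toTorus (f s)) * (f' s 1 : ℂ)) = 0 := by
  have hfc : Continuous f := continuous_pi fun i =>
    continuous_iff_continuousAt.2 fun s => (hf i s).continuousAt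
  have hc : Continuous fun s => UnitAddTorus.mFourier n (toTorus (f s)) :=
    (UnitAddTorus.mFourier n).continuous.comp (continuous_toTorus.comp hfc)
  have hi : ∀ i, Continuous fun s => UnitAddTorus.mFourier n (toTorus (f s)) * (f' s i : ℂ) :=
    fun i => hc.mul (Complex.continuous_ofReal.comp (hf' i))
  rw [← intervalIntegral.integral_const_mul, ← intervalIntegral.integral_const_mul,
    ← intervalIntegral.integral_add (((hi 0).intervalIntegrable _ _).const_mul _)
      (((hi 1).intervalIntegrable _ _).const_mul _)]
  have hpi : (2 * Real.pi * Complex.I : ℂ) ≠ 0 := Complex.two_pi_I_ne_zero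
  have hd : ∀ s ∈ Set.uIcc (0 : ℝ) 1,
      HasDerivAt (fun s => UnitAddTorus.mFourier n (toTorus (f s)) / (2 * Real.pi * Complex.I))
        ((n 0 : ℂ) * (UnitAddTorus.mFourier n (toTorus (f s)) * (f' s 0 : ℂ)) +
          n 1 * (UnitAddTorus.mFourier n (toTorus (f s)) * (f' s 1 : ℂ))) s := by
    intro s _
    have h1 : HasDerivAt (fun s => (n 0 * f s 0 + n 1 * f s 1 : ℝ))
        (n 0 * f' s 0 + n 1 * f' s 1) s :=
      ((hf 0 s).const_mul _).add ((hf 1 s).const_mul _)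
    have h2 := ((h1.ofReal_comp.const_mul (2 * Real.pi * Complex.I)).cexp).div_const
      (2 * Real.pi * Complex.I)
    simp only [mFourier_toTorus]
    refine h2.congr_deriv ?_
    rw [mul_left_comm, mul_div_cancel_left₀ _ hpi]
    push_cast
    ring
  rw [intervalIntegral.integral_eq_sub_of_hasDerivAt hd
    (((continuous_const.mul (hi 0)).add (continuous_const.mul (hi 1))).intervalIntegrable _ _)]
  have : toTorus (f 1) = toTorus (f 0) := by
    funext i
    obtain ⟨k, hk⟩ := hint i
    rw [toTorus, toTorus, hk]
    have : ((k : ℝ) : UnitAddCircle) = 0 := by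
      rw [AddCircle.coe_eq_zero_iff]
      exact ⟨k, by simp⟩
    rw [AddCircle.coe_add, this, add_zero]
  rw [this, sub_self]

section Degree

open MeasureTheory

variable {f f' g g' : ℝ → Fin 2 → ℝ}

/-- The degree formula for `(s, t) ↦ f s + g t`, tested on the characters of the torus: only the
trivial character contributes. -/
theorem integral_mFourier_mul_jacobian
    (hf : ∀ i s, HasDerivAt (fun s => f s i) (f' s i) s) (hf' : ∀ i, Continuous fun s => f' s i)
    (hg : ∀ i s, HasDerivAt (fun s => g s i) (g' s i) s) (hg' : ∀ i, Continuous fun s => g' s i)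
    (hf0 : f 0 = 0) (hf1 : f 1 = ![1, 0]) (hg0 : g 0 = 0) (hg1 : g 1 = ![0, 1])
    (n : Fin 2 → ℤ) :
    ∫ z : ℝ × ℝ, UnitAddTorus.mFourier n (toTorus (f z.1 + g z.2)) *
        ((f' z.1 0 * g' z.2 1 - f' z.1 1 * g' z.2 0 : ℝ) : ℂ)
        ∂((volume.restrict (Set.Ioc (0 : ℝ) 1)).prod (volume.restrict (Set.Ioc (0 : ℝ) 1))) =
      ∫ x, UnitAddTorus.mFourier n x ∂torusHaar := by
  have cont : ∀ {f f' : ℝ → Fin 2 → ℝ}, (∀ i s, HasDerivAt (fun s => f s i) (f' s i) s) →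
      (∀ i, Continuous fun s => f' s i) → ∀ i,
      Continuous fun s => UnitAddTorus.mFourier n (toTorus (f s)) * (f' s i : ℂ) := by
    intro f f' hf hf' i
    have hfc : Continuous f := continuous_pi fun i =>
      continuous_iff_continuousAt.2 fun s => (hf i s).continuousAt
    exact ((UnitAddTorus.mFourier n).continuous.comp (continuous_toTorus.comp hfc)).mul
      (Complex.continuous_ofReal.comp (hf' i))
  have hA := cont hf hf'
  have hB := cont hg hg'
  have int : ∀ {h : ℝ → ℂ}, Continuous h → Integrable h (volume.restrict (Set.Ioc (0 : ℝ) 1)) :=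
    fun hh => (hh.integrableOn_Icc (a := 0) (b := 1)).mono_set Set.Ioc_subset_Icc_self
  have hsplit : ∀ z : ℝ × ℝ, UnitAddTorus.mFourier n (toTorus (f z.1 + g z.2)) *
        ((f' z.1 0 * g' z.2 1 - f' z.1 1 * g' z.2 0 : ℝ) : ℂ) =
      (UnitAddTorus.mFourier n (toTorus (f z.1)) * (f' z.1 0 : ℂ)) *
        (UnitAddTorus.mFourier n (toTorus (g z.2)) * (g' z.2 1 : ℂ)) -
      (UnitAddTorus.mFourier n (toTorus (f z.1)) * (f' z.1 1 : ℂ)) *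
        (UnitAddTorus.mFourier n (toTorus (g z.2)) * (g' z.2 0 : ℂ)) := by
    intro z
    have : UnitAddTorus.mFourier n (toTorus (f z.1 + g z.2)) =
        UnitAddTorus.mFourier n (toTorus (f z.1)) * UnitAddTorus.mFourier n (toTorus (g z.2)) := by
      simp only [mFourier_toTorus, ← Complex.exp_add, Pi.add_apply]
      congr 1
      push_cast
      ring
    rw [this]
    push_cast
    ring
  simp_rw [hsplit]
  rw [integral_sub ((int (hA 0)).mul_prod (int (hB 1))) ((int (hA 1)).mul_prod (int (hB 0))),
    integral_prod_mul (fun s => UnitAddTorus.mFourier n (toTorus (f s)) * (f' s 0 : ℂ))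
      (fun t => UnitAddTorus.mFourier n (toTorus (g t)) * (g' t 1 : ℂ)),
    integral_prod_mul (fun s => UnitAddTorus.mFourier n (toTorus (f s)) * (f' s 1 : ℂ))
      (fun t => UnitAddTorus.mFourier n (toTorus (g t)) * (g' t 0 : ℂ)), integral_mFourier]
  simp only [← intervalIntegral.integral_of_le (zero_le_one' ℝ)]
  have hf2 := integral_character_deriv_eq_zero hf hf' (by
    intro i
    fin_cases i
    · exact ⟨1, by simp [hf0, hf1]⟩
    · exact ⟨0, by simp [hf0, hf1]⟩) n
  have hg2 := integral_character_deriv_eq_zero hg hg' (by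
    intro i
    fin_cases i
    · exact ⟨0, by simp [hg0, hg1]⟩
    · exact ⟨1, by simp [hg0, hg1]⟩) n
  split_ifs with h0
  · have prim : ∀ {f f' : ℝ → Fin 2 → ℝ}, (∀ i s, HasDerivAt (fun s => f s i) (f' s i) s) →
        (∀ i, Continuous fun s => f' s i) → ∀ i,
        ∫ s in (0 : ℝ)..1, UnitAddTorus.mFourier n (toTorus (f s)) * (f' s i : ℂ) =
          ((f 1 i - f 0 i : ℝ) : ℂ) := by
      intro f f' hf hf' i
      simp only [h0, UnitAddTorus.mFourier_zero, ContinuousMap.one_apply, one_mul]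
      rw [intervalIntegral.integral_ofReal, intervalIntegral.integral_eq_sub_of_hasDerivAt
        (fun s _ => hf i s) ((hf' i).intervalIntegrable _ _)]
    rw [prim hf hf', prim hf hf', prim hg hg', prim hg hg']
    simp [hf0, hf1, hg0, hg1]
  · -- both vectors of integrals are orthogonal to `n ≠ 0`, so they are parallel
    generalize (∫ s in (0 : ℝ)..1, UnitAddTorus.mFourier n (toTorus (f s)) * (f' s 0 : ℂ)) = a at *
    generalize (∫ s in (0 : ℝ)..1, UnitAddTorus.mFourier n (toTorus (f s)) * (f' s 1 : ℂ)) = b at *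
    generalize (∫ s in (0 : ℝ)..1, UnitAddTorus.mFourier n (toTorus (g s)) * (g' s 0 : ℂ)) = c at *
    generalize (∫ s in (0 : ℝ)..1, UnitAddTorus.mFourier n (toTorus (g s)) * (g' s 1 : ℂ)) = d at *
    obtain ⟨i, hi⟩ := Function.ne_iff.mp h0
    have key : (n i : ℂ) * (a * d - b * c) = 0 := by
      fin_cases i
      · change (n 0 : ℂ) * (a * d - b * c) = 0
        linear_combination d * hf2 - b * hg2
      · change (n 1 : ℂ) * (a * d - b * c) = 0
        linear_combination a * hg2 - c * hf2
    exact (mul_eq_zero.mp key).resolve_left (by exact_mod_cast hi)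

/-- Two smooth closed curves of classes `(1, 0)` and `(0, 1)` have all of the torus as their
sum: otherwise a bump function supported off the sum would violate the degree formula. -/
theorem exists_toTorus_add_eq
    (hf : ∀ i s, HasDerivAt (fun s => f s i) (f' s i) s) (hf' : ∀ i, Continuous fun s => f' s i)
    (hg : ∀ i s, HasDerivAt (fun s => g s i) (g' s i) s) (hg' : ∀ i, Continuous fun s => g' s i)
    (hf0 : f 0 = 0) (hf1 : f 1 = ![1, 0]) (hg0 : g 0 = 0) (hg1 : g 1 = ![0, 1])
    (p : UnitAddTorus (Fin 2)) :
    ∃ s ∈ Set.Icc (0 : ℝ) 1, ∃ t ∈ Set.Icc (0 : ℝ) 1, toTorus (f s + g t) = p := by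
  classical
  have hfc : Continuous f := continuous_pi fun i =>
    continuous_iff_continuousAt.2 fun s => (hf i s).continuousAt
  have hgc : Continuous g := continuous_pi fun i =>
    continuous_iff_continuousAt.2 fun s => (hg i s).continuousAt
  set F : ℝ × ℝ → UnitAddTorus (Fin 2) := fun z => toTorus (f z.1 + g z.2) with hF
  have hFc : Continuous F := continuous_toTorus.comp
    ((hfc.comp continuous_fst).add (hgc.comp continuous_snd))
  set S : Set (UnitAddTorus (Fin 2)) := F '' (Set.Icc (0 : ℝ) 1 ×ˢ Set.Icc (0 : ℝ) 1) with hS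
  have hSc : IsCompact S := (isCompact_Icc.prod isCompact_Icc).image hFc
  by_contra hcon
  have hpS : p ∉ S := by
    rintro ⟨z, hz, hzp⟩
    exact hcon ⟨z.1, hz.1, z.2, hz.2, hzp⟩
  obtain ⟨φ, hφ0, hφ1, hφ⟩ := exists_continuous_zero_one_of_isClosed hSc.isClosed
    (isClosed_singleton (x := p)) (Set.disjoint_singleton_right.2 hpS)
  have hpos : 0 < ∫ x, φ x ∂torusHaar :=
    φ.continuous.integral_pos_of_hasCompactSupport_nonneg_nonzero
      (HasCompactSupport.of_compactSpace _) (fun x => (hφ x).1) (x := p)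
      (by rw [hφ1 rfl]; exact one_ne_zero)
  set ν := (volume.restrict (Set.Ioc (0 : ℝ) 1)).prod (volume.restrict (Set.Ioc (0 : ℝ) 1)) with hν
  set D : ℝ × ℝ → ℂ := fun z => ((f' z.1 0 * g' z.2 1 - f' z.1 1 * g' z.2 0 : ℝ) : ℂ) with hD
  have hDc : Continuous D := Complex.continuous_ofReal.comp
    ((((hf' 0).comp continuous_fst).mul ((hg' 1).comp continuous_snd)).sub
      (((hf' 1).comp continuous_fst).mul ((hg' 0).comp continuous_snd)))
  have hνr : ν = volume.restrict (Set.Ioc (0 : ℝ) 1 ×ˢ Set.Ioc (0 : ℝ) 1) := by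
    rw [hν, Measure.prod_restrict]; rfl
  have hint : ∀ {h : ℝ × ℝ → ℂ}, Continuous h → Integrable h ν := by
    intro h hh
    rw [hνr]
    exact (hh.continuousOn.integrableOn_compact (isCompact_Icc.prod isCompact_Icc)).mono_set
      (Set.prod_mono Set.Ioc_subset_Icc_self Set.Ioc_subset_Icc_self)
  have hintT : ∀ q : C(UnitAddTorus (Fin 2), ℂ), Integrable q torusHaar := fun q =>
    q.continuous.integrable_of_hasCompactSupport (HasCompactSupport.of_compactSpace _)
  have hspan : ∀ q ∈ Submodule.span ℂ
      (Set.range (UnitAddTorus.mFourier : (Fin 2 → ℤ) → C(UnitAddTorus (Fin 2), ℂ))),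
      ∫ z, q (F z) * D z ∂ν = ∫ x, q x ∂torusHaar := by
    intro q hq
    induction hq using Submodule.span_induction with
    | mem q hq =>
      obtain ⟨n, rfl⟩ := hq
      exact integral_mFourier_mul_jacobian hf hf' hg hg' hf0 hf1 hg0 hg1 n
    | zero => simp
    | add q r _ _ hq hr =>
      simp only [ContinuousMap.add_apply, add_mul]
      have h1 : Integrable (fun z => q (F z) * D z) ν := hint ((q.continuous.comp hFc).mul hDc)
      have h2 : Integrable (fun z => r (F z) * D z) ν := hint ((r.continuous.comp hFc).mul hDc)
      rw [integral_add h1 h2, integral_add (hintT q) (hintT r), hq, hr]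
    | smul c q _ hq =>
      simp only [ContinuousMap.smul_apply, smul_eq_mul, mul_assoc]
      rw [integral_const_mul, integral_const_mul, hq]
  set φc : C(UnitAddTorus (Fin 2), ℂ) := ⟨fun x => (φ x : ℂ),
    Complex.continuous_ofReal.comp φ.continuous⟩ with hφc
  set C : ℝ := ∫ z, ‖D z‖ ∂ν with hC
  have hC0 : 0 ≤ C := integral_nonneg fun z => norm_nonneg _
  set I : ℝ := ∫ x, φ x ∂torusHaar with hI
  -- an approximation error `ε` changes the two sides of the degree formula by `ε * C` and `ε`
  have hε : 0 < I / (C + 2) := by positivity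
  have hmem : φc ∈ (Submodule.span ℂ
      (Set.range (UnitAddTorus.mFourier : (Fin 2 → ℤ) → C(UnitAddTorus (Fin 2), ℂ)))
      ).topologicalClosure := by
    rw [UnitAddTorus.span_mFourier_closure_eq_top]; trivial
  obtain ⟨q, hq, hqd⟩ := Metric.mem_closure_iff.1 hmem _ hε
  set ε := I / (C + 2) with hεd
  have hclose : ∀ x, ‖(φ x : ℂ) - q x‖ ≤ ε := fun x => by
    rw [dist_eq_norm] at hqd
    exact ((φc - q).norm_coe_le_norm x).trans hqd.le
  have h1 : ‖∫ z, q (F z) * D z ∂ν‖ ≤ ε * C := by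
    rw [hC, ← integral_const_mul]
    refine norm_integral_le_of_norm_le ((hint hDc).norm.const_mul _) ?_
    rw [hνr]
    filter_upwards [ae_restrict_mem (measurableSet_Ioc.prod measurableSet_Ioc)] with z hz
    have hzS : F z ∈ S := ⟨z, ⟨Set.Ioc_subset_Icc_self hz.1, Set.Ioc_subset_Icc_self hz.2⟩, rfl⟩
    have := hclose (F z)
    rw [hφ0 hzS] at this
    rw [norm_mul]
    refine mul_le_mul_of_nonneg_right ?_ (norm_nonneg _)
    simpa using this
  have h2 : ‖(I : ℂ) - ∫ x, q x ∂torusHaar‖ ≤ ε := by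
    have : (I : ℂ) = ∫ x, φc x ∂torusHaar := (integral_ofReal (f := fun x => φ x)).symm
    rw [this, ← integral_sub (hintT φc) (hintT q)]
    have h := norm_integral_le_of_norm_le_const (μ := torusHaar)
      (f := fun x => φc x - q x) (Filter.Eventually.of_forall hclose)
    simpa using h
  have h3 : I ≤ ε + ε * C := by
    have h4 : ‖(I : ℂ)‖ ≤ ε + ε * C := by
      rw [← hspan q hq] at h2
      calc ‖(I : ℂ)‖ = ‖((I : ℂ) - ∫ z, q (F z) * D z ∂ν) + ∫ z, q (F z) * D z ∂ν‖ := by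
            rw [sub_add_cancel]
        _ ≤ _ := (norm_add_le _ _).trans (add_le_add h2 h1)
    rwa [Complex.norm_real, Real.norm_of_nonneg hpos.le] at h4
  have h5 : ε * (C + 2) = I := div_mul_cancel₀ _ (by positivity)
  nlinarith

end Degree

/-! ### Sums of two planar continua -/

section SumOfContinua

open scoped Pointwise

/-- Points of a connected planar set are joined by smooth (in fact polynomial) curves that stay as
close to the set as desired. -/
theorem IsConnected.exists_smooth_path_near {K : Set (Fin 2 → ℝ)} (hK : IsConnected K)
    {x y : Fin 2 → ℝ} (hx : x ∈ K) (hy : y ∈ K) {ε : ℝ} (hε : 0 < ε) :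
    ∃ f f' : ℝ → Fin 2 → ℝ, (∀ i s, HasDerivAt (fun s => f s i) (f' s i) s) ∧
      (∀ i, Continuous fun s => f' s i) ∧ f 0 = x ∧ f 1 = y ∧
      ∀ s ∈ Set.Icc (0 : ℝ) 1, ∃ k ∈ K, dist (f s) k < ε := by
  have hU : IsConnected (Metric.thickening (ε / 3) K) := by
    have h0 : (0 : ℝ) < ε / 3 := by positivity
    rw [← add_ball_zero, ← Set.add_image_prod]
    exact (hK.prod ((convex_ball (0 : Fin 2 → ℝ) _).isConnected ⟨0, by simpa using h0⟩)).image
      (fun z => z.1 + z.2) (by fun_prop)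
  have hsub : K ⊆ Metric.thickening (ε / 3) K := Metric.self_subset_thickening (by positivity) K
  obtain ⟨γ, hγ⟩ := (Metric.isOpen_thickening.isConnected_iff_isPathConnected.1 hU).joinedIn x
    (hsub hx) y (hsub hy)
  have hp : ∀ i : Fin 2, ∃ p : Polynomial ℝ, ∀ s ∈ Set.Icc (0 : ℝ) 1,
      |p.eval s - γ.extend s i| < ε / 3 := fun i =>
    exists_polynomial_near_of_continuousOn 0 1 (fun s => γ.extend s i)
      ((continuous_apply i).comp γ.continuous_extend).continuousOn _ (by positivity)
  choose p hp using hp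
  -- a linear correction moves the end points of the approximating curve to `x` and `y`
  let q : Fin 2 → Polynomial ℝ := fun i => p i +
    ((1 - Polynomial.X) * Polynomial.C (x i - (p i).eval 0) +
      Polynomial.X * Polynomial.C (y i - (p i).eval 1))
  have hq : ∀ i s, (q i).eval s = (p i).eval s +
      ((1 - s) * (x i - (p i).eval 0) + s * (y i - (p i).eval 1)) := by
    intro i s
    simp [q]
  refine ⟨fun s i => (q i).eval s, fun s i => (q i).derivative.eval s,
    fun i s => (q i).hasDerivAt s, fun i => (q i).derivative.continuous, ?_, ?_, ?_⟩
  · funext i; simp [hq]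
  · funext i; simp [hq]
  · intro s hs
    have hmem : γ.extend s ∈ Metric.thickening (ε / 3) K := by
      rw [γ.extend_apply hs]
      exact hγ _
    obtain ⟨k, hk, hd⟩ := Metric.mem_thickening_iff.1 hmem
    refine ⟨k, hk, ?_⟩
    have h2 : dist (fun i => (q i).eval s) (γ.extend s) ≤ 2 * (ε / 3) := by
      refine (dist_pi_le_iff (by positivity)).2 fun i => ?_
      rw [Real.dist_eq, hq]
      have e0 := hp i 0 ⟨le_rfl, zero_le_one⟩
      have e1 := hp i 1 ⟨zero_le_one, le_rfl⟩
      have es := hp i s hs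
      simp only [Path.extend_zero, Path.extend_one] at e0 e1
      rw [abs_lt] at e0 e1 es
      obtain ⟨hs0, hs1⟩ := hs
      rw [abs_le]
      constructor <;> nlinarith
    calc dist (fun i => (q i).eval s) k ≤ _ + _ := dist_triangle _ (γ.extend s) k
      _ < ε := by linarith

theorem dist_toTorus_le (x y : Fin 2 → ℝ) : dist (toTorus x) (toTorus y) ≤ dist x y := by
  refine (dist_pi_le_iff dist_nonneg).2 fun i => ?_
  refine le_trans ?_ (dist_le_pi_dist x y i)
  rw [dist_eq_norm, dist_eq_norm]
  exact QuotientAddGroup.norm_mk_le_norm (m := x i - y i)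

theorem exists_int_of_toTorus_eq {x y : Fin 2 → ℝ} (h : toTorus x = toTorus y) :
    ∃ z : Fin 2 → ℤ, x = (fun i => (z i : ℝ)) + y := by
  have : ∀ i, ∃ z : ℤ, x i = z + y i := by
    intro i
    have hi : ((x i - y i : ℝ) : UnitAddCircle) = 0 := by
      rw [AddCircle.coe_sub, sub_eq_zero]
      exact congrFun h i
    obtain ⟨z, hz⟩ := (AddCircle.coe_eq_zero_iff (1 : ℝ)).1 hi
    exact ⟨z, by simp at hz; linarith⟩
  choose z hz using this
  exact ⟨z, funext hz⟩

/-- The lattice translates of the sum of two continua joining `0` to the two basis vectors cover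
the plane. -/
theorem exists_toTorus_add_eq_of_isConnected {K L : Set (Fin 2 → ℝ)} (hKc : IsCompact K)
    (hLc : IsCompact L) (hK : IsConnected K) (hL : IsConnected L) (hK0 : 0 ∈ K)
    (hK1 : ![1, 0] ∈ K) (hL0 : 0 ∈ L) (hL1 : ![0, 1] ∈ L) (p : UnitAddTorus (Fin 2)) :
    p ∈ toTorus '' (K + L) := by
  have hcl : IsClosed (toTorus '' (K + L)) := ((hKc.add hLc).image continuous_toTorus).isClosed
  rw [← hcl.closure_eq]
  refine Metric.mem_closure_iff.2 fun ε hε => ?_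
  obtain ⟨f, f', hf, hf', hf0, hf1, hfK⟩ := hK.exists_smooth_path_near hK0 hK1 (half_pos hε)
  obtain ⟨g, g', hg, hg', hg0, hg1, hgL⟩ := hL.exists_smooth_path_near hL0 hL1 (half_pos hε)
  obtain ⟨s, hs, t, ht, hp⟩ := exists_toTorus_add_eq hf hf' hg hg' hf0 hf1 hg0 hg1 p
  obtain ⟨k, hk, hkd⟩ := hfK s hs
  obtain ⟨l, hl, hld⟩ := hgL t ht
  refine ⟨toTorus (k + l), ⟨k + l, Set.add_mem_add hk hl, rfl⟩, ?_⟩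
  rw [← hp]
  calc dist (toTorus (f s + g t)) (toTorus (k + l)) ≤ dist (f s + g t) (k + l) :=
        dist_toTorus_le _ _
    _ ≤ dist (f s) k + dist (g t) l := dist_add_add_le _ _ _ _
    _ < ε := by linarith

theorem interior_add_nonempty_of_standard {K L : Set (Fin 2 → ℝ)} (hKc : IsCompact K)
    (hLc : IsCompact L) (hK : IsConnected K) (hL : IsConnected L) (hK0 : 0 ∈ K)
    (hK1 : ![1, 0] ∈ K) (hL0 : 0 ∈ L) (hL1 : ![0, 1] ∈ L) : (interior (K + L)).Nonempty := by
  -- countably many translates of `K + L` cover the plane, so Baire's theorem applies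
  have hcover : ⋃ z : Fin 2 → ℤ, (fun x => (fun i => (z i : ℝ)) + x) '' (K + L) = Set.univ := by
    refine Set.eq_univ_of_forall fun x => ?_
    obtain ⟨y, hy, hxy⟩ := exists_toTorus_add_eq_of_isConnected hKc hLc hK hL hK0 hK1 hL0 hL1
      (toTorus x)
    obtain ⟨z, hz⟩ := exists_int_of_toTorus_eq hxy.symm
    exact Set.mem_iUnion.2 ⟨z, y, hy, hz.symm⟩
  obtain ⟨z, hz⟩ := nonempty_interior_of_iUnion_of_closed (fun z : Fin 2 → ℤ =>
    ((hKc.add hLc).image (continuous_const_add (fun i => (z i : ℝ)))).isClosed) hcover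
  have := (Homeomorph.addLeft (fun i => (z i : ℝ))).image_interior (K + L)
  rw [Homeomorph.coe_addLeft] at this
  rw [← this] at hz
  exact hz.of_image

/-- If two planar continua contain `0` and, respectively, `a` and `b` with `a`, `b` linearly
independent, then their sum has non-empty interior. -/
theorem interior_add_nonempty {K L : Set (Fin 2 → ℝ)} (hKc : IsCompact K)
    (hLc : IsCompact L) (hK : IsConnected K) (hL : IsConnected L) {a b : Fin 2 → ℝ} (hK0 : 0 ∈ K)
    (hK1 : a ∈ K) (hL0 : 0 ∈ L) (hL1 : b ∈ L) (hab : LinearIndependent ℝ ![a, b]) :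
    (interior (K + L)).Nonempty := by
  let B := basisOfLinearIndependentOfCardEqFinrank hab (by simp)
  let e := B.equivFun.toContinuousLinearEquiv
  have hBa : B 0 = a := by simp [B]
  have hBb : B 1 = b := by simp [B]
  have hea : e a = ![1, 0] := by
    rw [← hBa]
    change B.equivFun (B 0) = _
    ext i
    fin_cases i <;> simp [Module.Basis.equivFun_self]
  have heb : e b = ![0, 1] := by
    rw [← hBb]
    change B.equivFun (B 1) = _
    ext i
    fin_cases i <;> simp [Module.Basis.equivFun_self]
  have h := interior_add_nonempty_of_standard (hKc.image e.continuous) (hLc.image e.continuous)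
    (hK.image e e.continuous.continuousOn) (hL.image e e.continuous.continuousOn)
    ⟨0, hK0, map_zero e⟩ ⟨a, hK1, hea⟩ ⟨0, hL0, map_zero e⟩ ⟨b, hL1, heb⟩
  rw [← Set.image_add] at h
  have h2 := e.toHomeomorph.image_interior (K + L)
  change e '' interior (K + L) = interior (e '' (K + L)) at h2
  rw [← h2] at h
  exact h.of_image

end SumOfContinua

/-! ### Attractors -/

section Attractors

/-- Continuous maps that send a non-empty compact set into itself have an attractor. -/
theorem IsAttractor.exists_of_image_subset {X : Type*} [TopologicalSpace X] [T2Space X]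
    {f g : X → X} (hf : Continuous f) (hg : Continuous g) {Q : Set X} (hQ : IsCompact Q)
    (hne : Q.Nonempty) (hfQ : f '' Q ⊆ Q) (hgQ : g '' Q ⊆ Q) : ∃ A, IsAttractor f g A := by
  let Φ : Set X → Set X := fun B => f '' B ∪ g '' B
  have hmono : Monotone Φ := fun B C h => Set.union_subset_union (Set.image_mono h)
    (Set.image_mono h)
  let q : ℕ → Set X := fun n => Φ^[n] Q
  have hsucc : ∀ n, q (n + 1) = Φ (q n) := fun n => Function.iterate_succ_apply' Φ n Q
  have hstep : ∀ n, q (n + 1) ⊆ q n := by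
    intro n
    induction n with
    | zero => exact Set.union_subset hfQ hgQ
    | succ n ih => rw [hsucc (n + 1)]; exact (hmono ih).trans (hsucc n).ge
  have hanti : Antitone q := antitone_nat_of_succ_le hstep
  have hcomp : ∀ n, IsCompact (q n) := by
    intro n
    induction n with
    | zero => exact hQ
    | succ n ih => rw [hsucc]; exact (ih.image hf).union (ih.image hg)
  have hnonempty : ∀ n, (q n).Nonempty := by
    intro n
    induction n with
    | zero => exact hne
    | succ n ih => rw [hsucc]; exact (ih.image f).inl
  have hpre : ∀ {h : X → X}, Continuous h → ∀ x, (∀ n, x ∈ h '' q n) → x ∈ h '' ⋂ n, q n := by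
    intro h hh x hx
    have hcl : IsClosed (h ⁻¹' {x}) := isClosed_singleton.preimage hh
    obtain ⟨y, hy⟩ := IsCompact.nonempty_iInter_of_sequence_nonempty_isCompact_isClosed
      (fun n => q n ∩ h ⁻¹' {x}) (fun n => Set.inter_subset_inter_left _ (hstep n))
      (fun n => by obtain ⟨y, hy, hyx⟩ := hx n; exact ⟨y, hy, hyx⟩)
      ((hcomp 0).inter_right hcl) (fun n => (hcomp n).isClosed.inter hcl)
    rw [Set.mem_iInter] at hy
    exact ⟨y, Set.mem_iInter.2 fun n => (hy n).1, (hy 0).2⟩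
  refine ⟨⋂ n, q n, ?_, ?_, ?_⟩
  · exact IsCompact.nonempty_iInter_of_sequence_nonempty_isCompact_isClosed q hstep hnonempty
      (hcomp 0) fun n => (hcomp n).isClosed
  · exact (hcomp 0).of_isClosed_subset (isClosed_iInter fun n => (hcomp n).isClosed)
      (Set.iInter_subset q 0)
  · apply Set.Subset.antisymm
    · intro x hx
      rw [Set.mem_iInter] at hx
      by_cases h : ∀ n, x ∈ f '' q n
      · exact Or.inl (hpre hf x h)
      · obtain ⟨m, hm⟩ := not_forall.1 h
        refine Or.inr (hpre hg x fun n => ?_)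
        have hx' := hx (max m n + 1)
        rw [hsucc] at hx'
        rcases hx' with h1 | h1
        · exact absurd (Set.image_mono (hanti (le_max_left m n)) h1) hm
        · exact Set.image_mono (hanti (le_max_right m n)) h1
    · refine Set.subset_iInter fun n => (?_ : _ ⊆ q n)
      refine Set.Subset.trans ?_ (hstep n)
      rw [hsucc]
      exact hmono (Set.iInter_subset q n)

theorem IsAttractor.left_mem {X : Type*} [TopologicalSpace X] {f g : X → X} {A : Set X}
    (hA : IsAttractor f g A) {a : X} (ha : a ∈ A) : f a ∈ A := by
  rw [hA.eq_union]; exact Or.inl ⟨a, ha, rfl⟩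

theorem IsAttractor.right_mem {X : Type*} [TopologicalSpace X] {f g : X → X} {A : Set X}
    (hA : IsAttractor f g A) {a : X} (ha : a ∈ A) : g a ∈ A := by
  rw [hA.eq_union]; exact Or.inr ⟨a, ha, rfl⟩

variable {V : Type*} [NormedAddCommGroup V] [NormedSpace ℝ V]

/-- Two operators contract jointly if the norms of the products `S ^ i * T ^ j` decay
geometrically in `i + j`. For commuting `S` and `T` these are all the products of `S` and `T`. -/
def JointlyContracting (S T : V →L[ℝ] V) : Prop :=
  ∃ C ρ : ℝ, 0 ≤ C ∧ 0 < ρ ∧ ρ < 1 ∧ ∀ i j x, ‖(S ^ i * T ^ j) x‖ ≤ C * ρ ^ (i + j) * ‖x‖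

/-- The norms of the powers of `S` decay geometrically. -/
def PowerContracting (S : V →L[ℝ] V) : Prop :=
  ∃ C ρ : ℝ, 0 ≤ C ∧ 0 < ρ ∧ ρ < 1 ∧ ∀ k x, ‖(S ^ k) x‖ ≤ C * ρ ^ k * ‖x‖

theorem PowerContracting.jointlyContracting {S T : V →L[ℝ] V} (hS : PowerContracting S)
    (hT : PowerContracting T) : JointlyContracting S T := by
  obtain ⟨C, ρ, hC, hρ0, hρ1, hS⟩ := hS
  obtain ⟨D, σ, hD, hσ0, hσ1, hT⟩ := hT
  refine ⟨C * D, max ρ σ, by positivity, lt_max_of_lt_left hρ0, max_lt hρ1 hσ1, fun i j x => ?_⟩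
  calc ‖(S ^ i) ((T ^ j) x)‖ ≤ C * ρ ^ i * ‖(T ^ j) x‖ := hS _ _
    _ ≤ C * ρ ^ i * (D * σ ^ j * ‖x‖) := by gcongr; exact hT _ _
    _ ≤ C * (max ρ σ) ^ i * (D * (max ρ σ) ^ j * ‖x‖) := by
      gcongr
      · exact le_max_left _ _
      · exact le_max_right _ _
    _ = _ := by rw [pow_add]; ring

theorem PowerContracting.mul {S T : V →L[ℝ] V} (hS : PowerContracting S)
    (hT : PowerContracting T) (hST : Commute S T) : PowerContracting (S * T) := by
  obtain ⟨C, ρ, hC, hρ0, hρ1, h⟩ := hS.jointlyContracting hT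
  refine ⟨C, ρ ^ 2, hC, by positivity, pow_lt_one₀ hρ0.le hρ1 two_ne_zero, fun k x => ?_⟩
  rw [hST.mul_pow, ← pow_mul, two_mul]
  exact (h k k x).trans_eq (by ring_nf)

theorem PowerContracting.tendsto_pow_apply {S : V →L[ℝ] V} (hS : PowerContracting S) (x : V) :
    Filter.Tendsto (fun k => (S ^ k) x) Filter.atTop (nhds 0) := by
  obtain ⟨C, ρ, hC, hρ0, hρ1, h⟩ := hS
  refine squeeze_zero_norm (h · x) ?_
  simpa using ((tendsto_pow_atTop_nhds_zero_of_lt_one hρ0.le hρ1).const_mul C).mul_const ‖x‖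

/-- A power contracting operator has no non-zero fixed vector. -/
theorem PowerContracting.eq_zero_of_apply_eq {S : V →L[ℝ] V} (hS : PowerContracting S) {x : V}
    (hx : S x = x) : x = 0 := by
  have : ∀ k, (S ^ k) x = x := by
    intro k
    induction k with
    | zero => rfl
    | succ k ih => rw [pow_succ]; exact (congrArg (S ^ k) hx).trans ih
  have h := hS.tendsto_pow_apply x
  simp only [this] at h
  exact tendsto_nhds_unique tendsto_const_nhds h

/-- The affine maps `x ↦ S x` and `x ↦ T x + u` have an attractor: the closed set of all `x` whose
images decay at the rate of `ρ` is compact and invariant when the constant is large. -/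
theorem JointlyContracting.exists_isAttractor [ProperSpace V] {S T : V →L[ℝ] V}
    (h : JointlyContracting S T) (hST : Commute S T) (u : V) :
    ∃ A, IsAttractor (fun x => S x) (fun x => T x + u) A := by
  obtain ⟨C, ρ, hC, hρ0, hρ1, hd⟩ := h
  -- the constant solves `R * ρ + C * ‖u‖ = R`
  set R : ℝ := C * ‖u‖ / (1 - ρ) with hR
  have h1ρ : 0 < 1 - ρ := by linarith
  have hR0 : 0 ≤ R := by positivity
  have hReq : R * ρ + C * ‖u‖ = R := by
    have : R * (1 - ρ) = C * ‖u‖ := div_mul_cancel₀ _ h1ρ.ne'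
    linarith
  let Q : Set V := {x | ∀ i j, ‖(S ^ i * T ^ j) x‖ ≤ R * ρ ^ (i + j)}
  have hQcl : IsClosed Q := by
    have : Q = ⋂ i, ⋂ j, {x | ‖(S ^ i * T ^ j) x‖ ≤ R * ρ ^ (i + j)} := by
      ext x; simp [Q]
    rw [this]
    exact isClosed_iInter fun i => isClosed_iInter fun j =>
      isClosed_le (S ^ i * T ^ j).continuous.norm continuous_const
  have hQ : IsCompact Q := by
    refine (isCompact_closedBall (0 : V) R).of_isClosed_subset hQcl fun x hx => ?_
    simpa using hx 0 0
  refine IsAttractor.exists_of_image_subset S.continuous (T.continuous.add continuous_const) hQ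
    ⟨0, fun i j => by simpa using by positivity⟩ ?_ ?_
  · rintro _ ⟨x, hx, rfl⟩ i j
    have e : (S ^ i * T ^ j) (S x) = (S ^ (i + 1) * T ^ j) x := by
      have : (S ^ i * T ^ j) * S = S ^ (i + 1) * T ^ j := by
        rw [mul_assoc, ← (hST.pow_right j).eq, ← mul_assoc, ← pow_succ]
      rw [← this]; rfl
    rw [e]
    refine (hx (i + 1) j).trans (mul_le_mul_of_nonneg_left ?_ hR0)
    exact pow_le_pow_of_le_one hρ0.le hρ1.le (by omega)
  · rintro _ ⟨x, hx, rfl⟩ i j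
    have e : (S ^ i * T ^ j) (T x + u) = (S ^ i * T ^ (j + 1)) x + (S ^ i * T ^ j) u := by
      rw [map_add, pow_succ T j, ← mul_assoc]; rfl
    rw [e]
    refine (norm_add_le _ _).trans ((add_le_add (hx i (j + 1)) (hd i j u)).trans (le_of_eq ?_))
    rw [← add_assoc, pow_succ]
    linear_combination ρ ^ (i + j) * hReq

/-- A bounded set `B` is contained in the closed set `A` if each point of `B` is the image of a point
of `B` under an affine map `x ↦ S ^ i (T ^ j x) + v` that sends `A` into itself. The maps in
question are the compositions of `x ↦ S x` and `x ↦ T x + u`, and `i + j` is their length. -/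
theorem JointlyContracting.subset_of_isClosed {S T : V →L[ℝ] V} (h : JointlyContracting S T)
    (hST : Commute S T) {A B : Set V} (hA : IsClosed A) (hne : A.Nonempty)
    (hB : Bornology.IsBounded B)
    (hstep : ∀ b ∈ B, ∃ i j : ℕ, 1 ≤ i + j ∧ ∃ v, (∀ a ∈ A, (S ^ i * T ^ j) a + v ∈ A) ∧
      ∃ b' ∈ B, b = (S ^ i * T ^ j) b' + v) : B ⊆ A := by
  obtain ⟨C, ρ, hC, hρ0, hρ1, hd⟩ := h
  -- the maps may be taken of any length `n`, so that they bring `B` and `A` as close as desired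
  have hiter : ∀ n : ℕ, ∀ b ∈ B, ∃ i j : ℕ, n ≤ i + j ∧
      ∃ v, (∀ a ∈ A, (S ^ i * T ^ j) a + v ∈ A) ∧ ∃ b' ∈ B, b = (S ^ i * T ^ j) b' + v := by
    intro n
    induction n with
    | zero => exact fun b hb => ⟨0, 0, le_rfl, 0, fun a ha => by simpa using ha, b, hb, by simp⟩
    | succ n ih =>
      intro b hb
      obtain ⟨i, j, hij, v, hv, b', hb', rfl⟩ := ih b hb
      obtain ⟨i', j', hij', v', hv', b'', hb'', rfl⟩ := hstep b' hb'
      have e : ∀ x, (S ^ i * T ^ j) ((S ^ i' * T ^ j') x + v') + v =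
          (S ^ (i + i') * T ^ (j + j')) x + ((S ^ i * T ^ j) v' + v) := by
        intro x
        have : (S ^ i * T ^ j) * (S ^ i' * T ^ j') = S ^ (i + i') * T ^ (j + j') := by
          rw [mul_assoc, ← mul_assoc (T ^ j), (hST.symm.pow_pow j i').eq, pow_add, pow_add]
          simp only [mul_assoc]
        rw [← this, map_add, add_assoc]; rfl
      exact ⟨i + i', j + j', by omega, (S ^ i * T ^ j) v' + v,
        fun a ha => by rw [← e]; exact hv _ (hv' a ha), b'', hb'', e _⟩
  obtain ⟨a, ha⟩ := hne
  obtain ⟨r, hr⟩ := hB.subset_closedBall a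
  intro b hb
  rw [← hA.closure_eq]
  have hr0 : 0 ≤ r := dist_nonneg.trans (hr hb)
  refine Metric.mem_closure_iff.2 fun ε hε => ?_
  obtain ⟨n, hn⟩ := (((tendsto_pow_atTop_nhds_zero_of_lt_one hρ0.le hρ1).const_mul
    (C * r)).eventually (gt_mem_nhds (by simpa using hε))).exists
  obtain ⟨i, j, hij, v, hv, b', hb', rfl⟩ := hiter n b hb
  refine ⟨_, hv a ha, ?_⟩
  rw [dist_add_right, dist_eq_norm, ← map_sub]
  have h1 : ‖b' - a‖ ≤ r := by
    have := hr hb'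
    rwa [Metric.mem_closedBall, dist_eq_norm] at this
  have h2 : ρ ^ (i + j) ≤ ρ ^ n := pow_le_pow_of_le_one hρ0.le hρ1.le hij
  calc _ ≤ C * ρ ^ (i + j) * ‖b' - a‖ := hd _ _ _
    _ ≤ C * ρ ^ n * r := by gcongr
    _ = C * r * ρ ^ n := by ring
    _ < ε := hn

theorem JointlyContracting.isAttractor_subset {S T : V →L[ℝ] V} (h : JointlyContracting S T)
    (hST : Commute S T) {u : V} {A B : Set V}
    (hA : IsAttractor (fun x => S x) (fun x => T x + u) A)
    (hB : IsAttractor (fun x => S x) (fun x => T x + u) B) : B ⊆ A := by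
  refine h.subset_of_isClosed hST hA.isCompact.isClosed hA.nonempty hB.isCompact.isBounded ?_
  intro b hb
  rw [hB.eq_union] at hb
  rcases hb with ⟨b', hb', rfl⟩ | ⟨b', hb', rfl⟩
  · exact ⟨1, 0, le_rfl, 0, fun a ha => by simpa using hA.left_mem ha, b', hb', by simp⟩
  · exact ⟨0, 1, le_rfl, u, fun a ha => by simpa using hA.right_mem ha, b', hb', by simp⟩

theorem JointlyContracting.existsUnique_isAttractor [ProperSpace V] {S T : V →L[ℝ] V}
    (h : JointlyContracting S T) (hST : Commute S T) (u : V) :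
    ∃! A, IsAttractor (fun x => S x) (fun x => T x + u) A := by
  obtain ⟨A, hA⟩ := h.exists_isAttractor hST u
  exact ⟨A, hA, fun B hB => Set.Subset.antisymm (h.isAttractor_subset hST hA hB)
    (h.isAttractor_subset hST hB hA)⟩

end Attractors

/-! ### Connectedness of attractors of large determinant -/

section Connected

open MeasureTheory
open scoped Pointwise

variable {V : Type*} [NormedAddCommGroup V] [NormedSpace ℝ V]

/-- Self-similarity passes constancy from one scale to the next larger one: a two-valued function
that does not distinguish points of the attractor `K` differing by an element of `Pⁿ (K - K)` is
constant on `K`, provided that the two first-level pieces of `K` meet. -/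
theorem IsAttractor.eq_of_forall_eq_of_sub_eq_pow_apply {P : V →L[ℝ] V} {w : V} {K : Set V}
    (hK : IsAttractor (fun x => P x) (fun x => P x + w) K)
    (hmeet : (((fun x => P x) '' K) ∩ ((fun x => P x + w) '' K)).Nonempty) (n : ℕ) :
    ∀ f : V → Bool,
      (∀ x ∈ K, ∀ y ∈ K, (∃ a ∈ K, ∃ b ∈ K, x - y = (P ^ n) (a - b)) → f x = f y) →
      ∀ x ∈ K, ∀ y ∈ K, f x = f y := by
  obtain ⟨z, ⟨y₀, hy₀, hy₀z⟩, ⟨y₁, hy₁, hy₁z⟩⟩ := hmeet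
  have hy : P y₀ = P y₁ + w := hy₀z.trans hy₁z.symm
  induction n with
  | zero => exact fun f hf x hx y hy => hf x hx y hy ⟨x, hx, y, hy, rfl⟩
  | succ n ih =>
    intro f hf
    have h0 : ∀ x ∈ K, ∀ y ∈ K, f (P x) = f (P y) := ih (fun x => f (P x)) (by
      rintro x hx y hy ⟨a, ha, b, hb, hab⟩
      refine hf _ (hK.left_mem hx) _ (hK.left_mem hy) ⟨a, ha, b, hb, ?_⟩
      rw [← map_sub, hab, pow_succ']; rfl)
    have h1 : ∀ x ∈ K, ∀ y ∈ K, f (P x + w) = f (P y + w) := ih (fun x => f (P x + w)) (by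
      rintro x hx y hy ⟨a, ha, b, hb, hab⟩
      refine hf _ (hK.right_mem hx) _ (hK.right_mem hy) ⟨a, ha, b, hb, ?_⟩
      rw [add_sub_add_right_eq_sub, ← map_sub, hab, pow_succ']; rfl)
    have hall : ∀ x ∈ K, f x = f (P y₀) := by
      intro x hx
      rw [hK.eq_union] at hx
      rcases hx with ⟨x', hx', rfl⟩ | ⟨x', hx', rfl⟩
      · exact h0 x' hx' y₀ hy₀
      · exact (h1 x' hx' y₁ hy₁).trans (congrArg f hy.symm)
    exact fun x hx y hy => (hall x hx).trans (hall y hy).symm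

/-- If the two first-level pieces of the attractor meet, then the attractor is connected. -/
theorem PowerContracting.isConnected_of_inter_nonempty {P : V →L[ℝ] V} (hP : PowerContracting P)
    {w : V} {K : Set V} (hK : IsAttractor (fun x => P x) (fun x => P x + w) K)
    (hmeet : (((fun x => P x) '' K) ∩ ((fun x => P x + w) '' K)).Nonempty) : IsConnected K := by
  obtain ⟨C, ρ, hC, hρ0, hρ1, hP⟩ := hP
  refine ⟨hK.nonempty, isPreconnected_of_forall_constant fun f hf => ?_⟩
  let g : V → ℝ := fun x => if f x then 1 else 0
  have hg : ContinuousOn g K :=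
    (continuous_of_discreteTopology (f := fun b : Bool => if b then (1 : ℝ) else 0)).comp_continuousOn
      hf
  obtain ⟨δ, hδ, hgδ⟩ := Metric.uniformContinuousOn_iff.1
    (hK.isCompact.uniformContinuousOn_of_continuous hg) 1 one_pos
  obtain ⟨r, hr⟩ := Metric.isBounded_iff.1 hK.isCompact.isBounded
  obtain ⟨n, hn⟩ := (((tendsto_pow_atTop_nhds_zero_of_lt_one hρ0.le hρ1).const_mul
    (C * r)).eventually (gt_mem_nhds (by simpa using hδ))).exists
  refine hK.eq_of_forall_eq_of_sub_eq_pow_apply hmeet n f ?_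
  rintro x hx y hy ⟨a, ha, b, hb, hab⟩
  have hd : dist x y < δ := by
    rw [dist_eq_norm, hab]
    have h1 : ‖a - b‖ ≤ r := by rw [← dist_eq_norm]; exact hr ha hb
    calc _ ≤ C * ρ ^ n * ‖a - b‖ := hP _ _
      _ ≤ C * ρ ^ n * r := by gcongr
      _ = C * r * ρ ^ n := by ring
      _ < δ := hn
  have := hgδ x hx y hy hd
  by_contra hne
  have hg1 : dist (g x) (g y) = 1 := by
    simp only [g]
    cases hfx : f x <;> cases hfy : f y
    · exact absurd (hfx.trans hfy.symm) hne
    · simp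
    · simp
    · exact absurd (hfx.trans hfy.symm) hne
  exact absurd hg1 this.ne

variable [FiniteDimensional ℝ V] [MeasurableSpace V] [BorelSpace V] [Nontrivial V]

/-- If the two first-level pieces were disjoint, then the neighbourhoods `K + Pⁿ G` of the attractor
`K`, for a suitable open `G`, would not shrink in volume as `n` grows, although they decrease
to `K`. Hence `K` would have full measure in `K + G`, which is absurd. -/
theorem PowerContracting.inter_nonempty {P : V →L[ℝ] V} (hP : PowerContracting P)
    (hdet : 1 / 2 ≤ |LinearMap.det (P : V →ₗ[ℝ] V)|) {w : V} {K : Set V}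
    (hK : IsAttractor (fun x => P x) (fun x => P x + w) K) :
    (((fun x => P x) '' K) ∩ ((fun x => P x + w) '' K)).Nonempty := by
  obtain ⟨C, ρ, hC, hρ0, hρ1, hP⟩ := hP
  by_contra hdisj
  rw [Set.not_nonempty_iff_eq_empty, ← Set.disjoint_iff_inter_eq_empty] at hdisj
  set μ : Measure V := Measure.addHaar with hμ
  have hKc := hK.isCompact
  have hdet0 : LinearMap.det (P : V →ₗ[ℝ] V) ≠ 0 := by
    intro h; rw [h] at hdet; norm_num at hdet
  have hopen : IsOpenMap P := by
    have := ((P : V →ₗ[ℝ] V).equivOfDetNeZero hdet0).toContinuousLinearEquiv.toHomeomorph.isOpenMap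
    exact this
  obtain ⟨r, hr, hrd⟩ := hdisj.exists_thickenings (hKc.image P.continuous)
    (hKc.image (P.continuous.add continuous_const)).isClosed
  set δ : ℝ := r / (C + 1) with hδ
  have hδ0 : 0 < δ := by positivity
  -- an open neighbourhood of `0` with `P G ⊆ G`, so that `P` maps `K + Pⁿ G` into `P K + Pⁿ⁺¹ G`;
  -- its size keeps the two images of `K + Pⁿ G` apart
  let G : Set V := ⋃ k : ℕ, (P ^ k) '' Metric.ball 0 δ
  have hopenpow : ∀ (k : ℕ) (s : Set V), IsOpen s → IsOpen ((P ^ k) '' s) := by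
    intro k
    induction k with
    | zero => intro s hs; simpa using hs
    | succ k ih =>
      intro s hs
      have : (P ^ (k + 1)) '' s = (P ^ k) '' (P '' s) := by rw [pow_succ, Set.image_image]; rfl
      rw [this]
      exact ih _ (hopen _ hs)
  have hGo : IsOpen G := isOpen_iUnion fun k => hopenpow k _ Metric.isOpen_ball
  have hG0 : (0 : V) ∈ G := Set.mem_iUnion.2 ⟨0, 0, by simpa using hδ0, by simp⟩
  have hPG : ∀ n : ℕ, ∀ x ∈ G, ‖(P ^ n) x‖ < r * ρ ^ n := by
    intro n x hx
    obtain ⟨k, y, hy, rfl⟩ := Set.mem_iUnion.1 hx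
    have e : (P ^ n) ((P ^ k) y) = (P ^ (n + k)) y := by rw [pow_add]; rfl
    rw [e]
    rw [mem_ball_zero_iff] at hy
    have h1 : ρ ^ (n + k) ≤ ρ ^ n := pow_le_pow_of_le_one hρ0.le hρ1.le (by omega)
    calc _ ≤ C * ρ ^ (n + k) * ‖y‖ := hP _ _
      _ ≤ C * ρ ^ n * δ := by gcongr
      _ < (C + 1) * ρ ^ n * δ := by gcongr; linarith
      _ = r * ρ ^ n := by rw [hδ]; field_simp
  let U : ℕ → Set V := fun n => K + (P ^ n) '' G
  have hUo : ∀ n, IsOpen (U n) := fun n => (hopenpow n G hGo).add_left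
  have hKU : K ⊆ U 0 := fun x hx => ⟨x, hx, 0, ⟨0, hG0, by simp⟩, by simp⟩
  have hUth : ∀ n, U n ⊆ Metric.thickening (r * ρ ^ n) K := by
    rintro n _ ⟨x, hx, _, ⟨y, hy, rfl⟩, rfl⟩
    exact Metric.mem_thickening_iff.2 ⟨x, hx, by simpa [dist_eq_norm] using hPG n y hy⟩
  have himg : ∀ n, ∀ v : V, (fun x => P x + v) '' U n ⊆
      Metric.thickening r ((fun x => P x + v) '' K) := by
    rintro n v _ ⟨_, ⟨x, hx, _, ⟨y, hy, rfl⟩, rfl⟩, rfl⟩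
    refine Metric.mem_thickening_iff.2 ⟨_, ⟨x, hx, rfl⟩, ?_⟩
    have e : P ((P ^ n) y) = (P ^ (n + 1)) y := by rw [pow_succ']; rfl
    have h1 : ρ ^ (n + 1) ≤ 1 := pow_le_one₀ hρ0.le hρ1.le
    have h2 := hPG (n + 1) y hy
    simp only [map_add, e, dist_eq_norm, add_sub_add_right_eq_sub, add_sub_cancel_left]
    nlinarith
  have hvol : ∀ n, ∀ v : V, μ ((fun x => P x + v) '' U n) =
      ENNReal.ofReal |LinearMap.det (P : V →ₗ[ℝ] V)| * μ (U n) := by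
    intro n v
    have : (fun x => P x + v) '' U n = (fun x => x + v) '' ((P : V →ₗ[ℝ] V) '' U n) := by
      rw [Set.image_image]; rfl
    rw [this, Set.image_add_right, measure_preimage_add_right, Measure.addHaar_image_linearMap]
  have hmono : ∀ n, μ (U n) ≤ μ (U (n + 1)) := by
    intro n
    have hsub : ((fun x => P x + 0) '' U n) ∪ ((fun x => P x + w) '' U n) ⊆ U (n + 1) := by
      have e : ∀ y, P ((P ^ n) y) = (P ^ (n + 1)) y := fun y => by rw [pow_succ']; rfl
      rintro _ (⟨_, ⟨x, hx, _, ⟨y, hy, rfl⟩, rfl⟩, rfl⟩ | ⟨_, ⟨x, hx, _, ⟨y, hy, rfl⟩, rfl⟩, rfl⟩)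
      · exact ⟨P x, hK.left_mem hx, _, ⟨y, hy, rfl⟩, by simp only [map_add, e, add_zero]⟩
      · refine ⟨P x + w, hK.right_mem hx, _, ⟨y, hy, rfl⟩, ?_⟩
        simp only [map_add, e]
        abel
    have hd : Disjoint ((fun x => P x + 0) '' U n) ((fun x => P x + w) '' U n) :=
      hrd.mono (by simpa using himg n 0) (himg n w)
    have hmeas : MeasurableSet ((fun x => P x + w) '' U n) := by
      have : (fun x => P x + w) '' U n = (fun x => x + w) '' (P '' U n) := by
        rw [Set.image_image]
      rw [this]
      exact (isOpenMap_add_right w _ (hopen _ (hUo n))).measurableSet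
    refine le_trans ?_ (measure_mono hsub)
    rw [measure_union hd hmeas, hvol, hvol, ← add_mul]
    have : (1 : ENNReal) ≤ ENNReal.ofReal |LinearMap.det (P : V →ₗ[ℝ] V)| +
        ENNReal.ofReal |LinearMap.det (P : V →ₗ[ℝ] V)| := by
      rw [← ENNReal.ofReal_add (abs_nonneg _) (abs_nonneg _)]
      exact ENNReal.one_le_ofReal.2 (by linarith)
    simpa using mul_le_mul_left this (μ (U n))
  have hmono0 : ∀ n, μ (U 0) ≤ μ (U n) := fun n => monotone_nat_of_le_succ hmono (Nat.zero_le n)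
  have hlim : Filter.Tendsto (fun n : ℕ => μ (Metric.cthickening (r * ρ ^ n) K)) Filter.atTop
      (nhds (μ K)) := by
    refine (tendsto_measure_cthickening_of_isCompact hKc).comp ?_
    simpa using (tendsto_pow_atTop_nhds_zero_of_lt_one hρ0.le hρ1).const_mul r
  have hle : μ (U 0) ≤ μ K := ge_of_tendsto' hlim fun n =>
    (hmono0 n).trans (measure_mono ((hUth n).trans (Metric.thickening_subset_cthickening _ _)))
  have hdiff : μ (U 0 \ K) = 0 := by
    rw [measure_sdiff hKU hKc.measurableSet.nullMeasurableSet hKc.measure_lt_top.ne]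
    exact tsub_eq_zero_of_le hle
  have hempty : U 0 \ K = ∅ := ((hUo 0).sdiff hKc.isClosed).measure_eq_zero_iff μ |>.1 hdiff
  have hKeq : K = U 0 := hKU.antisymm (Set.sdiff_eq_empty.1 hempty)
  have huniv : K = Set.univ :=
    IsClopen.eq_univ ⟨hKc.isClosed, hKeq ▸ hUo 0⟩ hK.nonempty
  have := NormedSpace.noncompactSpace ℝ V
  exact noncompact_univ V (huniv ▸ hKc)

theorem PowerContracting.isConnected {P : V →L[ℝ] V} (hP : PowerContracting P)
    (hdet : 1 / 2 ≤ |LinearMap.det (P : V →ₗ[ℝ] V)|) {w : V} {K : Set V}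
    (hK : IsAttractor (fun x => P x) (fun x => P x + w) K) : IsConnected K :=
  hP.isConnected_of_inter_nonempty hK (hP.inter_nonempty hdet hK)

end Connected

/-! ### Planar attractors with interior -/

section Planar

open scoped Pointwise

/-- Let `N` be a contracting operator of the plane with `|det N| ≥ 1 / √2`, and let `v' - v` be a
cyclic vector of `N`. Then a translate of `K + N K`, where `K` is the attractor of `x ↦ N² x` and
`x ↦ N² x + (v' - v)`, is covered by its images under `x ↦ N x + v` and `x ↦ N x + v'`,
and it has interior because `K` is a continuum. -/
theorem PowerContracting.exists_subset_with_interior {N : (Fin 2 → ℝ) →L[ℝ] (Fin 2 → ℝ)}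
    (hN : PowerContracting N)
    (hdet : 1 / √2 ≤ |LinearMap.det (N : (Fin 2 → ℝ) →ₗ[ℝ] (Fin 2 → ℝ))|) {v v' : Fin 2 → ℝ}
    (hw : LinearIndependent ℝ ![v' - v, N (v' - v)]) :
    ∃ B : Set (Fin 2 → ℝ), IsCompact B ∧ (interior B).Nonempty ∧
      ∀ b ∈ B, ∃ b' ∈ B, b = N b' + v ∨ b = N b' + v' := by
  set w := v' - v with hwdef
  have hP : PowerContracting (N * N) := hN.mul hN (Commute.refl N)
  obtain ⟨K, hK⟩ := (hP.jointlyContracting hP).exists_isAttractor (Commute.refl _) w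
  have hdetP : 1 / 2 ≤ |LinearMap.det ((N * N : (Fin 2 → ℝ) →L[ℝ] (Fin 2 → ℝ)) :
      (Fin 2 → ℝ) →ₗ[ℝ] (Fin 2 → ℝ))| := by
    have e : ((N * N : (Fin 2 → ℝ) →L[ℝ] (Fin 2 → ℝ)) : (Fin 2 → ℝ) →ₗ[ℝ] (Fin 2 → ℝ)) =
      (N : (Fin 2 → ℝ) →ₗ[ℝ] (Fin 2 → ℝ)) * N := rfl
    rw [e, map_mul, abs_mul]
    have h2 : (1 / √2 : ℝ) * (1 / √2) = 1 / 2 := by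
      rw [div_mul_div_comm, Real.mul_self_sqrt (by norm_num), one_mul]
    rw [← h2]
    exact mul_le_mul hdet hdet (by positivity) (abs_nonneg _)
  have hKconn := hP.isConnected hdetP hK
  have h0 : (0 : Fin 2 → ℝ) ∈ K := by
    obtain ⟨a, ha⟩ := hK.nonempty
    have hmem : ∀ n, ((N * N) ^ n) a ∈ K := by
      intro n
      induction n with
      | zero => exact ha
      | succ n ih => rw [pow_succ']; exact hK.left_mem ih
    exact hK.isCompact.isClosed.mem_of_tendsto (hP.tendsto_pow_apply a)
      (Filter.Eventually.of_forall hmem)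
  have hwK : w ∈ K := by simpa using hK.right_mem h0
  have hint := interior_add_nonempty hK.isCompact (hK.isCompact.image N.continuous) hKconn
    (hKconn.image N N.continuous.continuousOn) h0 hwK ⟨0, h0, map_zero N⟩ ⟨w, hwK, rfl⟩ hw
  -- the fixed point of `x ↦ N x + v`
  obtain ⟨c, hc⟩ : ∃ c, c - N c = v := by
    have hinj : Function.Injective
        ((1 - N : (Fin 2 → ℝ) →L[ℝ] (Fin 2 → ℝ)) : (Fin 2 → ℝ) →ₗ[ℝ] (Fin 2 → ℝ)) := by
      refine (injective_iff_map_eq_zero _).2 fun x hx => hN.eq_zero_of_apply_eq ?_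
      exact (sub_eq_zero.1 hx).symm
    exact LinearMap.injective_iff_surjective.1 hinj v
  refine ⟨(fun x => c + x) '' (K + N '' K), ?_, ?_, ?_⟩
  · exact (hK.isCompact.add (hK.isCompact.image N.continuous)).image (continuous_const_add c)
  · have := (Homeomorph.addLeft c).image_interior (K + N '' K)
    rw [Homeomorph.coe_addLeft] at this
    rw [← this]
    exact hint.image _
  · rintro _ ⟨_, ⟨x, hx, _, ⟨y, hy, rfl⟩, rfl⟩, rfl⟩
    rw [hK.eq_union] at hx
    have hcv : c = N c + v := by rw [← hc]; abel
    rcases hx with ⟨x', hx', rfl⟩ | ⟨x', hx', rfl⟩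
    · refine ⟨c + (y + N x'), ⟨_, ⟨y, hy, _, ⟨x', hx', rfl⟩, rfl⟩, rfl⟩, Or.inl ?_⟩
      change c + (N (N x') + N y) = _
      nth_rewrite 1 [hcv]
      simp only [map_add]
      abel
    · refine ⟨c + (y + N x'), ⟨_, ⟨y, hy, _, ⟨x', hx', rfl⟩, rfl⟩, rfl⟩, Or.inr ?_⟩
      change c + (N (N x') + w + N y) = _
      nth_rewrite 1 [hcv]
      simp only [map_add, hwdef]
      abel

/-- If `u`, `S u`, `T u` span, then an operator that commutes with `S` and `T` and has `u` as an
eigenvector is scalar. -/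
theorem eq_smul_one_of_apply_eq_smul {V : Type*} [NormedAddCommGroup V] [NormedSpace ℝ V]
    {S T N : V →L[ℝ] V} {u : V} (hu : Submodule.span ℝ {u, S u, T u} = ⊤)
    (hNS : Commute N S) (hNT : Commute N T) {c : ℝ} (hc : N u = c • u) : N = c • 1 := by
  have hcomm : ∀ {R : V →L[ℝ] V}, Commute N R → N (R u) = c • R u := fun {R} h => by
    rw [← map_smul, ← hc]; exact congrArg (· u) h.eq
  ext x
  have hx : x ∈ Submodule.span ℝ {u, S u, T u} := hu ▸ Submodule.mem_top
  refine LinearMap.eqOn_span (f := (N : V →ₗ[ℝ] V)) (g := ((c • 1 : V →L[ℝ] V) : V →ₗ[ℝ] V)) ?_ hx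
  rintro y (rfl | rfl | rfl)
  · exact hc
  · exact hcomm hNS
  · exact hcomm hNT

/-- The vector `u - S u` is cyclic for a non-scalar operator that commutes with `S` and `T`: were it
an eigenvector, then so would be `u`, because `1 - S` is injective. -/
theorem PowerContracting.linearIndependent_sub {V : Type*} [NormedAddCommGroup V]
    [NormedSpace ℝ V] {S T N : V →L[ℝ] V} (hS : PowerContracting S) {u : V}
    (hu : Submodule.span ℝ {u, S u, T u} = ⊤)
    (hNS : Commute N S) (hNT : Commute N T) (hN : ¬ ∃ c : ℝ, N = c • 1) :
    LinearIndependent ℝ ![u - S u, N (u - S u)] := by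
  have hkey : ∀ c : ℝ, N (u - S u) ≠ c • (u - S u) := by
    intro c hc
    refine hN ⟨c, eq_smul_one_of_apply_eq_smul hu hNS hNT ?_⟩
    have hfix : S (N u - c • u) = N u - c • u := by
      have h1 : N (S u) = S (N u) := congrArg (· u) hNS.eq
      rw [map_sub, h1, smul_sub] at hc
      rw [map_sub, map_smul]
      have h2 := sub_eq_zero.2 hc
      rw [eq_comm, ← sub_eq_zero, ← h2]
      abel
    exact sub_eq_zero.1 (hS.eq_zero_of_apply_eq hfix)
  have hne : u - S u ≠ 0 := fun h => hkey 0 (by simp [h])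
  exact (LinearIndependent.pair_iff' hne).2 fun c hc => hkey c hc.symm

/-- The attractor has interior as soon as some non-scalar product `N = S ^ i * T ^ j` with
`|det N| ≥ 1 / √2` is the linear part of two compositions of the two maps whose translation
parts are `S u` and `u`. -/
theorem IsAttractor.interior_nonempty {S T : (Fin 2 → ℝ) →L[ℝ] (Fin 2 → ℝ)}
    (hS : PowerContracting S) (hT : PowerContracting T) (hST : Commute S T) {u : Fin 2 → ℝ}
    (hu : Submodule.span ℝ {u, S u, T u} = ⊤) {A : Set (Fin 2 → ℝ)}
    (hA : IsAttractor (fun x => S x) (fun x => T x + u) A) {i j : ℕ} (hij : 1 ≤ i + j)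
    (hN : PowerContracting (S ^ i * T ^ j)) (hscalar : ¬ ∃ c : ℝ, S ^ i * T ^ j = c • 1)
    (hdet : 1 / √2 ≤ |LinearMap.det
      ((S ^ i * T ^ j : (Fin 2 → ℝ) →L[ℝ] (Fin 2 → ℝ)) : (Fin 2 → ℝ) →ₗ[ℝ] (Fin 2 → ℝ))|)
    (h₁ : ∀ a ∈ A, (S ^ i * T ^ j) a + S u ∈ A) (h₂ : ∀ a ∈ A, (S ^ i * T ^ j) a + u ∈ A) :
    (interior A).Nonempty := by
  have hNS : Commute (S ^ i * T ^ j) S :=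
    ((Commute.refl S).pow_left i).mul_left (hST.symm.pow_left j)
  have hNT : Commute (S ^ i * T ^ j) T :=
    (hST.pow_left i).mul_left ((Commute.refl T).pow_left j)
  obtain ⟨B, hBc, hBi, hB⟩ := hN.exists_subset_with_interior hdet
    (hS.linearIndependent_sub hu hNS hNT hscalar)
  refine hBi.mono (interior_mono ?_)
  refine (hS.jointlyContracting hT).subset_of_isClosed hST hA.isCompact.isClosed hA.nonempty
    hBc.isBounded fun b hb => ?_
  obtain ⟨b', hb', h | h⟩ := hB b hb
  · exact ⟨i, j, hij, _, h₁, b', hb', h⟩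
  · exact ⟨i, j, hij, _, h₂, b', hb', h⟩

end Planar

/-! ### Contracting matrices -/

section Matrices

/-- The operator `x ↦ M x` of the plane with the matrix `M`. -/
noncomputable def mulVecCLM (M : Matrix (Fin 2) (Fin 2) ℝ) : (Fin 2 → ℝ) →L[ℝ] (Fin 2 → ℝ) :=
  LinearMap.toContinuousLinearMap (Matrix.toLin' M)

theorem mulVecCLM_apply (M : Matrix (Fin 2) (Fin 2) ℝ) (x : Fin 2 → ℝ) :
    mulVecCLM M x = M.mulVec x := rfl

theorem mulVecCLM_mul (M N : Matrix (Fin 2) (Fin 2) ℝ) :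
    mulVecCLM (M * N) = mulVecCLM M * mulVecCLM N := by
  ext1 x
  exact (Matrix.mulVec_mulVec x M N).symm

theorem mulVecCLM_one : mulVecCLM 1 = 1 := by
  ext1 x
  exact Matrix.one_mulVec x

theorem mulVecCLM_pow (M : Matrix (Fin 2) (Fin 2) ℝ) (k : ℕ) :
    mulVecCLM (M ^ k) = mulVecCLM M ^ k := by
  induction k with
  | zero => exact mulVecCLM_one
  | succ k ih => rw [pow_succ, mulVecCLM_mul, ih, pow_succ]

theorem det_mulVecCLM (M : Matrix (Fin 2) (Fin 2) ℝ) :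
    LinearMap.det (mulVecCLM M : (Fin 2 → ℝ) →ₗ[ℝ] (Fin 2 → ℝ)) = M.det :=
  LinearMap.det_toLin' M

theorem mulVecCLM_eq_smul_one_iff {M : Matrix (Fin 2) (Fin 2) ℝ} {c : ℝ} :
    mulVecCLM M = c • 1 ↔ M = c • (1 : Matrix (Fin 2) (Fin 2) ℝ) := by
  have e : mulVecCLM (c • (1 : Matrix (Fin 2) (Fin 2) ℝ)) = c • 1 := by
    ext1 x
    rw [mulVecCLM_apply, Matrix.smul_mulVec, Matrix.one_mulVec]; rfl
  rw [← e]
  exact (LinearMap.toContinuousLinearMap.injective.comp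
    (Matrix.toLin' (R := ℝ) (m := Fin 2) (n := Fin 2)).injective).eq_iff

attribute [local instance] Matrix.linftyOpNormedAddCommGroup Matrix.linftyOpNormedSpace
  Matrix.linftyOpNormedRing Matrix.linftyOpNormedAlgebra

theorem norm_map_algebraMap_complex (M : Matrix (Fin 2) (Fin 2) ℝ) :
    ‖M.map (algebraMap ℝ ℂ)‖ = ‖M‖ := by
  simp [Matrix.linfty_opNorm_def]

/-- Gelfand's formula bounds the powers of a contracting matrix geometrically. -/
theorem IsContractingMatrix.powerContracting {M : Matrix (Fin 2) (Fin 2) ℝ}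
    (hM : IsContractingMatrix M) : PowerContracting (mulVecCLM M) := by
  set a := M.map (algebraMap ℝ ℂ) with ha
  have hrad : spectralRadius ℂ a < ((1 : NNReal) : ENNReal) :=
    spectrum.spectralRadius_lt_of_forall_lt a fun z hz => hM z hz
  obtain ⟨ρ, hρ, hρ1⟩ := ENNReal.lt_iff_exists_nnreal_btwn.1 hrad
  have hρ1' : (ρ : ℝ) < 1 := by exact_mod_cast hρ1
  have hρ0 : (0 : ℝ) < ρ := by
    have : (0 : ENNReal) < ρ := bot_le.trans_lt hρ
    exact_mod_cast this
  have hO : (fun k => a ^ k) =O[Filter.atTop] fun k => (ρ : ℝ) ^ k := by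
    refine Asymptotics.IsBigO.of_bound 1 ?_
    filter_upwards [(spectrum.pow_nnnorm_pow_one_div_tendsto_nhds_spectralRadius a).eventually
      (gt_mem_nhds hρ), Filter.eventually_gt_atTop 0] with k hk hk0
    have hk0' : (0 : ℝ) < k := by exact_mod_cast hk0
    have h1 : (‖a ^ k‖₊ : ENNReal) < (ρ : ENNReal) ^ (k : ℝ) := by
      rw [← ENNReal.rpow_inv_lt_iff hk0', ← one_div]
      exact hk
    rw [ENNReal.rpow_natCast] at h1
    have h2 : ‖a ^ k‖₊ < ρ ^ k := by exact_mod_cast h1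
    rw [one_mul, Real.norm_of_nonneg (pow_nonneg hρ0.le k)]
    exact_mod_cast h2.le
  obtain ⟨C, hC, hb⟩ := Asymptotics.bound_of_isBigO_nat_atTop hO
  refine ⟨C, ρ, hC.le, hρ0, hρ1', fun k x => ?_⟩
  have hk := hb (x := k) (by positivity)
  rw [Real.norm_of_nonneg (pow_nonneg hρ0.le k), ha, ← Matrix.map_pow,
    norm_map_algebraMap_complex] at hk
  rw [← mulVecCLM_pow, mulVecCLM_apply]
  exact (Matrix.linfty_opNorm_mulVec _ _).trans (mul_le_mul_of_nonneg_right hk (norm_nonneg _))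

end Matrices

/-- If `M₀ M₁` is scalar but `M₀`, `M₁` are not both scalar, as the spanning condition
guarantees, then an invertible `M₀² M₁` is not scalar. -/
theorem not_isScalarMatrix_sq_mul {M₀ M₁ : Matrix (Fin 2) (Fin 2) ℝ} {u : Fin 2 → ℝ}
    (hu : Submodule.span ℝ {u, M₀.mulVec u, M₁.mulVec u} = ⊤) (h : IsScalarMatrix (M₀ * M₁))
    (hdet : (M₀ ^ 2 * M₁).det ≠ 0) : ¬ IsScalarMatrix (M₀ ^ 2 * M₁) := by
  rintro ⟨d, hd⟩
  obtain ⟨c, hc⟩ := h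
  have hd0 : d ≠ 0 := by rintro rfl; simp [hd] at hdet
  have h1 : c • M₀ = d • 1 := by rw [← hd, pow_two, mul_assoc, hc, mul_smul_comm, mul_one]
  have hc0 : c ≠ 0 := by
    rintro rfl
    rw [zero_smul] at h1
    have := congrFun (congrFun h1 0) 0
    simp at this
    exact hd0 this.symm
  have hM₀ : M₀ = (d / c) • 1 := by
    rw [div_eq_inv_mul, mul_smul, ← h1, inv_smul_smul₀ hc0]
  have hM₁ : M₁ = (c / (d / c)) • 1 := by
    rw [hM₀, smul_mul_assoc, one_mul] at hc
    rw [div_eq_inv_mul c, mul_smul, ← hc, inv_smul_smul₀ (div_ne_zero hd0 hc0)]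
  have hle : Submodule.span ℝ {u, M₀.mulVec u, M₁.mulVec u} ≤ Submodule.span ℝ {u} := by
    refine Submodule.span_le.2 ?_
    rintro y (rfl | rfl | rfl)
    · exact Submodule.mem_span_singleton_self _
    · rw [hM₀, Matrix.smul_mulVec, Matrix.one_mulVec]
      exact Submodule.smul_mem _ _ (Submodule.mem_span_singleton_self u)
    · rw [hM₁, Matrix.smul_mulVec, Matrix.one_mulVec]
      exact Submodule.smul_mem _ _ (Submodule.mem_span_singleton_self u)
  rw [hu] at hle
  have h2 := Submodule.finrank_mono hle
  have h3 := finrank_span_le_card (R := ℝ) ({u} : Set (Fin 2 → ℝ))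
  simp at h2 h3
  omega

theorem mainTheorem3
    (M₀ M₁ : Matrix (Fin 2) (Fin 2) ℝ) (u : Fin 2 → ℝ)
    (hM₀ : IsContractingMatrix M₀) (hM₁ : IsContractingMatrix M₁)
    (hcomm : M₀ * M₁ = M₁ * M₀)
    (hu : Submodule.span ℝ {u, M₀.mulVec u, M₁.mulVec u} = ⊤) :
    (∃! A : Set (Fin 2 → ℝ), IsAttractor (affineMapOf M₀ 0) (affineMapOf M₁ u) A) ∧
    ∀ A : Set (Fin 2 → ℝ), IsAttractor (affineMapOf M₀ 0) (affineMapOf M₁ u) A →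
      (¬ IsScalarMatrix (M₀ * M₁) → 1 / √2 ≤ |(M₀ * M₁).det| → (interior A).Nonempty) ∧
      (IsScalarMatrix (M₀ * M₁) → 1 / √2 ≤ |(M₀ ^ 2 * M₁).det| → (interior A).Nonempty) := by
  set S := mulVecCLM M₀ with hS
  set T := mulVecCLM M₁ with hT
  have hSc : PowerContracting S := hM₀.powerContracting
  have hTc : PowerContracting T := hM₁.powerContracting
  have hST : Commute S T := by
    change S * T = T * S
    rw [hS, hT, ← mulVecCLM_mul, hcomm, mulVecCLM_mul]
  have hf : affineMapOf M₀ 0 = fun x => S x := funext fun x => add_zero _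
  have hg : affineMapOf M₁ u = fun x => T x + u := rfl
  rw [hf, hg]
  have hu' : Submodule.span ℝ {u, S u, T u} = ⊤ := hu
  have hSTx : ∀ x, T (S x) = S (T x) := fun x => congrArg (· x) hST.eq.symm
  refine ⟨(hSc.jointlyContracting hTc).existsUnique_isAttractor hST u, fun A hA => ⟨?_, ?_⟩⟩
  · intro hscalar hdet
    have e : S ^ 1 * T ^ 1 = mulVecCLM (M₀ * M₁) := by rw [pow_one, pow_one, mulVecCLM_mul]
    have hx : ∀ x, (S ^ 1 * T ^ 1) x = S (T x) := fun x => by rw [pow_one, pow_one]; rfl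
    refine hA.interior_nonempty hSc hTc hST hu' (i := 1) (j := 1) (by norm_num) ?_ ?_ ?_ ?_ ?_
    · rw [pow_one, pow_one]
      exact hSc.mul hTc hST
    · rintro ⟨c, hc⟩
      exact hscalar ⟨c, mulVecCLM_eq_smul_one_iff.1 (e ▸ hc)⟩
    · rwa [e, det_mulVecCLM]
    · intro a ha
      rw [hx, ← map_add]
      exact hA.left_mem (hA.right_mem ha)
    · intro a ha
      rw [hx, ← hSTx]
      exact hA.right_mem (hA.left_mem ha)
  · intro hscalar hdet
    have e : S ^ 2 * T ^ 1 = mulVecCLM (M₀ ^ 2 * M₁) := by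
      rw [pow_one, mulVecCLM_mul, mulVecCLM_pow]
    have hx : ∀ x, (S ^ 2 * T ^ 1) x = S (S (T x)) := fun x => by rw [pow_one, pow_two]; rfl
    have hdet0 : (M₀ ^ 2 * M₁).det ≠ 0 := by
      intro h
      rw [h, abs_zero] at hdet
      exact absurd hdet (not_le.2 (by positivity))
    refine hA.interior_nonempty hSc hTc hST hu' (i := 2) (j := 1) (by norm_num) ?_ ?_ ?_ ?_ ?_
    · rw [pow_one, pow_two, mul_assoc]
      exact hSc.mul (hSc.mul hTc hST) ((Commute.refl S).mul_right hST)
    · rintro ⟨c, hc⟩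
      exact not_isScalarMatrix_sq_mul hu hscalar hdet0
        ⟨c, mulVecCLM_eq_smul_one_iff.1 (e ▸ hc)⟩
    · rwa [e, det_mulVecCLM]
    · intro a ha
      rw [hx, ← hSTx a, ← map_add]
      exact hA.left_mem (hA.right_mem (hA.left_mem ha))
    · intro a ha
      rw [hx, ← hSTx a, ← hSTx (S a)]
      exact hA.right_mem (hA.left_mem (hA.left_mem ha))
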